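/- Throughout, $\mathbb{K}=\mathbb{R}$ or $\mathbb{C}$, all spaces are Banach spaces over $\mathbb{K}$, all (multi)linear operators are continuous, and $E'$ denotes the topological dual of $E$. For a Banach space $E$: - for $0<q<\infty$, $\ell_q(E)$ is the set of sequences $(x_j)_{j\ge 1}$ in $E$ with $\sum_j\|x_j\|^q<\infty$; - for $1\le q<\infty$, $\|(x_j)_j\|_{w,q}=\sup_{\varphi\in E',\,\|\varphi\|\le 1}\big(\sum_j|\varphi(x_j)|^q\big)^{1/q}\in[0,\infty]$; - for $1<p<\infty$ and $\frac1p+\frac1{p^*}=1$, $\ell_p\langle E\rangle$ (the Cohen strongly $p$-summable sequences) is the set of sequences $(x_j)_j$ in $E$ with $$\sup\Big\{\sum_{j}|\varphi_j(x_j)| : (\varphi_j)_j \text{ in } E',\ \|(\varphi_j)_j\|_{w,p^*}\le 1\Big\}<\infty;$$ - $\mathrm{Rad}(E)$ (the almost unconditionally summable sequences) is the set of sequences $(x_j)_j$ in $E$ such that $\sum_j r_j(t)x_j$ converges in $E$ for Lebesgue-almost every $t\in[0,1]$, where $r_j(t)=\operatorname{sign}(\sin(2^j\pi t))$, $j\ge1$,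 are the Rademacher functions. Let $n\ge 1$ be an integer and $1<p<\infty$. An $n$-linear operator $A\colon E_1\times\cdots\times E_n\to F$ is *Cohen strongly $p$-summing* if $(A(x_j^1,\dots,x_j^n))_j\in\ell_p\langle F\rangle$ whenever $(x_j^m)_j\in\ell_{np}(E_m)$ for $m=1,\dots,n$; for $n=1$ this defines Cohen strongly $p$-summing linear operators. It is *Cohen almost summing* if $(A(x_j^1,\dots,x_j^n))_j\in\ell_2\langle F\rangle$ whenever $(x_j^m)_j\in\mathrm{Rad}(E_m)$ for $m=1,\dots,n$. **Corollary.** Let $1<p<\infty$, let $n\ge1$, and let $E_1,\dots,E_n,G_1,\dots,G_n,F$ be Banach spaces over $\mathbb{K}$. 1. Every Cohen strongly $p$-summing $n$-linear operator $A\colon E_1\times\cdots\times E_n\to F$ is Cohen almost summing. 2. If $u_m\colon E_m\to G_m$, $m=1,\dots,n$, are Cohen strongly $p$-summing linear operators and $B\colon G_1\times\cdots\times G_n\to F$ is a continuous $n$-linear operator, then $B\circ(u_1,\dots,u_n)$ is Cohen almost summing. Equivalently, $\mathcal{D}_p^n\cup(\mathcal{L}^n\circ\mathcal{D}_p)\subseteq\mathcal{D}_{as}^n$.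 -/

import Mathlib

open Filter Topology MeasureTheory
open scoped ENNReal

section CohenDefs

variable (𝕜 : Type*) [RCLike 𝕜]

/-- The Rademacher functions `sign (sin (2 ^ n * π * t))`, `n = 1, 2, …`, indexed from `0`. -/
noncomputable def rademacher (j : ℕ) (t : ℝ) : ℝ :=
  Real.sign (Real.sin (2 ^ (j + 1) * Real.pi * t))

/-- `Rad(E)`, the almost unconditionally summable sequences: the series `∑ r_j(t) x_j` converges
in norm for Lebesgue-almost every `t ∈ [0, 1]`. -/
def Rad (E : Type*) [NormedAddCommGroup E] [NormedSpace 𝕜 E] : Set (ℕ → E) :=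
  {x | ∀ᵐ t ∂(volume.restrict (Set.Icc (0 : ℝ) 1)),
    ∃ s : E, Tendsto (fun k : ℕ => ∑ j ∈ Finset.range k, (rademacher j t : 𝕜) • x j) atTop (𝓝 s)}

/-- `ℓ_p(E)`, the absolutely `p`-summable sequences, `0 < p < ∞`. -/
def absSummable (p : ℝ) (E : Type*) [NormedAddCommGroup E] : Set (ℕ → E) :=
  {x | Summable fun j => ‖x j‖ ^ p}

/-- The weak `q`-norm `sup_{‖φ‖ ≤ 1} (∑ |φ(x_j)| ^ q) ^ (1 / q)`, `1 ≤ q < ∞`, with value `∞` when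
the sequence is not weakly `q`-summable. -/
noncomputable def weakNorm (q : ℝ) {E : Type*} [NormedAddCommGroup E] [NormedSpace 𝕜 E]
    (x : ℕ → E) : ℝ≥0∞ :=
  ⨆ (φ : StrongDual 𝕜 E) (_ : ‖φ‖ ≤ 1), (∑' j, ‖φ (x j)‖ₑ ^ q) ^ (1 / q)

/-- The Cohen norm `sup ∑ |φ_j(x_j)|`, over all sequences `(φ_j)` in the closed unit ball of
`ℓ_{p*}^w(E')`, where `p* = p / (p - 1)` and `1 < p < ∞`. -/
noncomputable def cohenNorm (p : ℝ) {E : Type*} [NormedAddCommGroup E] [NormedSpace 𝕜 E]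
    (x : ℕ → E) : ℝ≥0∞ :=
  ⨆ (φ : ℕ → StrongDual 𝕜 E) (_ : weakNorm 𝕜 (p / (p - 1)) φ ≤ 1), ∑' j, ‖φ j (x j)‖ₑ

/-- `ℓ_p⟨E⟩`, the Cohen strongly `p`-summable sequences, `1 < p < ∞`. -/
def cohenSummable (p : ℝ) (E : Type*) [NormedAddCommGroup E] [NormedSpace 𝕜 E] :
    Set (ℕ → E) :=
  {x | cohenNorm 𝕜 p x < ∞}

variable {𝕜}

/-- A continuous multilinear operator is `(X_1, …, X_n; Y)`-summing if it maps sequences of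
`X_1, …, X_n`, coordinate by coordinate, to a sequence of `Y`. -/
def IsSumming {n : ℕ} {E : Fin n → Type*} [∀ m, NormedAddCommGroup (E m)]
    [∀ m, NormedSpace 𝕜 (E m)] {F : Type*} [NormedAddCommGroup F] [NormedSpace 𝕜 F]
    (X : ∀ m, Set (ℕ → E m)) (Y : Set (ℕ → F)) (A : ContinuousMultilinearMap 𝕜 E F) : Prop :=
  ∀ x : ∀ m, ℕ → E m, (∀ m, x m ∈ X m) → (fun j => A fun m => x m j) ∈ Y

/-- Cohen strongly `p`-summing `n`-linear operators (`1 < p < ∞`, `1 ≤ n`): absolutely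
`np`-summable sequences are sent to Cohen strongly `p`-summable sequences. -/
def IsCohenStronglySumming {n : ℕ} {E : Fin n → Type*} [∀ m, NormedAddCommGroup (E m)]
    [∀ m, NormedSpace 𝕜 (E m)] {F : Type*} [NormedAddCommGroup F] [NormedSpace 𝕜 F]
    (p : ℝ) (A : ContinuousMultilinearMap 𝕜 E F) : Prop :=
  IsSumming (fun m => absSummable (n * p) (E m)) (cohenSummable 𝕜 p F) A

/-- Cohen strongly `p`-summing linear operators, `1 < p < ∞`. -/
def IsCohenStronglySummingLinear {E F : Type*} [NormedAddCommGroup E] [NormedSpace 𝕜 E]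
    [NormedAddCommGroup F] [NormedSpace 𝕜 F] (p : ℝ) (u : E →L[𝕜] F) : Prop :=
  ∀ x ∈ absSummable p E, (fun j => u (x j)) ∈ cohenSummable 𝕜 p F

/-- Cohen almost summing `n`-linear operators: the `(Rad, …, Rad; ℓ_2⟨·⟩)`-summing ones. -/
def IsCohenAlmostSumming {n : ℕ} {E : Fin n → Type*} [∀ m, NormedAddCommGroup (E m)]
    [∀ m, NormedSpace 𝕜 (E m)] {F : Type*} [NormedAddCommGroup F] [NormedSpace 𝕜 F]
    (A : ContinuousMultilinearMap 𝕜 E F) : Prop :=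
  IsSumming (fun m => Rad 𝕜 (E m)) (cohenSummable 𝕜 2 F) A

end CohenDefs

/-!
For a choice of signs `ε` put `X_ε = ∑ ε_j x_j` and `Φ_ε = ∑ ε_j φ_j`. If `u : E → F` is Cohen
strongly `p`-summing, `x ∈ Rad(E)` and `(φ_j)` is weakly `2`-summable in `F'`, orthogonality of the
signs makes `∑ φ_j (u x_j)` the average of `Φ_ε (u X_ε)` over all `ε` (`sum_signs_decouple`).
Applied to the families `(X_ε)` and `(Φ_ε)`, indexed by the finitely many `ε`, Cohen's inequality
bounds this average by the `L_p` norm of `X` and the weak `L_{p*}` norm of `Φ`, since the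
normalizing powers of the number of signs cancel. The second is at most a constant times the weak
`2`-norm of `(φ_j)`, by Khintchine's inequality (`exists_khintchine`). The first is bounded
independently of the number of terms, by a theorem of Kahane (`exists_moment_bound_of_mem_Rad`):
almost sure convergence keeps the partial sums below some level with probability at least `1 / 2`,
and stopping a sum when it first passes a level shows that the tails decay geometrically
(`exceedProb_add_le`).

For an `n`-linear operator `A` it is enough that this applies to one variable `i`, the others being
fixed vectors `z`, with a constant proportional to `∏ ‖z_m‖`; this is `IsAverageBounded`, and both
parts of the theorem are instances of it. The other variables are removed one at a time, by
decoupling: for fixed signs `ε`, the sequence `x_j` in such a variable becomes the fixed vector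
`X_ε`, and `φ_j` becomes `ε_j φ_j` (`IsAverageBounded.exists_diagonal_bound`). The uniform constants
in Cohen's inequality come from the definition, by gluing sequences
(`IsCohenStronglySumming.exists_cohenNorm_le`).
-/

/-! ### Averages over signs -/

section Signs

variable {𝕜 : Type*} [RCLike 𝕜] {E : Type*} [NormedAddCommGroup E] [NormedSpace 𝕜 E]

variable (𝕜) in
/-- The sum `∑ ε_j x_j` over `j < N`, for a choice of signs `ε`; the space of all choices,
`Fin N → ℤˣ`, carries the uniform probability, so that expectations are sums divided by `2 ^ N`. -/
def signSum {N : ℕ} (x : ℕ → E) (ε : Fin N → ℤˣ) : E :=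
  ∑ j : Fin N, (((ε j : ℤˣ) : ℤ) : 𝕜) • x j

theorem norm_intUnits_cast (e : ℤˣ) : ‖((e : ℤ) : 𝕜)‖ = 1 := by
  rcases Int.units_eq_one_or e with rfl | rfl <;> simp

theorem sum_signs_succ {M : Type*} [AddCommMonoid M] (N : ℕ) (f : (Fin (N + 1) → ℤˣ) → M) :
    ∑ ε, f ε = ∑ ε : Fin N → ℤˣ, f (Fin.cons 1 ε) + ∑ ε : Fin N → ℤˣ, f (Fin.cons (-1) ε) := by
  rw [← (Fin.consEquiv (fun _ : Fin (N + 1) => ℤˣ)).sum_comp, Fintype.sum_prod_type,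
    show (Finset.univ : Finset ℤˣ) = {1, -1} from rfl, Finset.sum_pair (by decide)]
  rfl

theorem sum_sign_mul_sign (N : ℕ) (j k : Fin N) :
    ∑ ε : Fin N → ℤˣ, (((ε j : ℤ) : 𝕜) * ((ε k : ℤ) : 𝕜)) = if j = k then 2 ^ N else 0 := by
  split_ifs with h
  · subst h
    have h1 : ∀ ε : Fin N → ℤˣ, (((ε j : ℤ) : 𝕜) * ((ε j : ℤ) : 𝕜)) = 1 := fun ε => by
      rcases Int.units_eq_one_or (ε j) with h | h <;> simp [h]
    simp [h1]
  · -- Changing the sign of `ε_j` reverses the sign of the sum.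
    have h1 := Equiv.sum_comp (Equiv.mulLeft (Pi.mulSingle j (-1) : Fin N → ℤˣ))
      (fun ε : Fin N → ℤˣ => (((ε j : ℤ) : 𝕜) * ((ε k : ℤ) : 𝕜)))
    simp only [Equiv.coe_mulLeft, Pi.mul_apply, Pi.mulSingle_eq_same,
      Pi.mulSingle_eq_of_ne (Ne.symm h)] at h1
    simp only [Units.val_neg, Int.cast_neg, one_mul, neg_mul, Finset.sum_neg_distrib] at h1
    have h2 := add_eq_zero_iff_eq_neg.2 h1.symm
    rw [← two_mul] at h2
    exact (mul_eq_zero.1 h2).resolve_left two_ne_zero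

/-- Decoupling: the diagonal sum `∑ L_j x_j` is the average, over all signs, of
`∑_j ε_j L_j (∑_k ε_k x_k)`. -/
theorem sum_signs_decouple (N : ℕ) (l : Fin N → E →ₗ[𝕜] 𝕜) (x : ℕ → E) :
    ∑ ε : Fin N → ℤˣ, ∑ j, ((ε j : ℤ) : 𝕜) * l j (signSum 𝕜 x ε) =
      2 ^ N * ∑ j, l j (x j) := by
  simp only [signSum, map_sum, map_smul, smul_eq_mul, Finset.mul_sum]
  rw [Finset.sum_comm]
  refine Finset.sum_congr rfl fun j _ => ?_
  rw [Finset.sum_comm]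
  simp only [← mul_assoc, ← Finset.sum_mul, sum_sign_mul_sign]
  simp

theorem rpow_le_const_mul_exp (r : ℝ) {lam : ℝ} (hlam : 0 < lam) (hr : 0 ≤ r) :
    ∃ C : ℝ, 0 ≤ C ∧ ∀ v : ℝ, 0 ≤ v → v ^ r ≤ C * Real.exp (lam * v) := by
  set k := ⌈r⌉₊
  refine ⟨(lam ^ r)⁻¹ * (1 + k.factorial), by positivity, fun v hv => ?_⟩
  have hw : 0 ≤ lam * v := by positivity
  have h1 : (lam * v) ^ r ≤ 1 + (lam * v) ^ k := by
    rcases le_total (lam * v) 1 with h | h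
    · have := Real.rpow_le_one hw h hr
      have := pow_nonneg hw k
      linarith
    · have := Real.rpow_le_rpow_of_exponent_le h (Nat.le_ceil r)
      rw [Real.rpow_natCast] at this
      linarith
  have h2 : (lam * v) ^ k ≤ k.factorial * Real.exp (lam * v) := by
    have := Real.pow_div_factorial_le_exp (lam * v) hw k
    rwa [div_le_iff₀ (by positivity), mul_comm (Real.exp _)] at this
  have h3 : 1 ≤ Real.exp (lam * v) := Real.one_le_exp hw
  rw [Real.mul_rpow hlam.le hv] at h1
  have h4 : 0 < lam ^ r := by positivity
  rw [mul_assoc, inv_mul_eq_div, le_div_iff₀ h4]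
  linarith

theorem sum_signs_exp_le (N : ℕ) (a : Fin N → ℝ) :
    ∑ ε : Fin N → ℤˣ, Real.exp (∑ j, ((ε j : ℤ) : ℝ) * a j) ≤
      2 ^ N * Real.exp ((∑ j, a j ^ 2) / 2) := by
  have h1 : ∑ ε : Fin N → ℤˣ, Real.exp (∑ j, ((ε j : ℤ) : ℝ) * a j) =
      ∏ j, ∑ e : ℤˣ, Real.exp ((e : ℤ) * a j) := by
    rw [Finset.prod_univ_sum, Fintype.piFinset_univ]
    simp only [Real.exp_sum]
  have h2 : ∀ j, ∑ e : ℤˣ, Real.exp ((e : ℤ) * a j) = 2 * Real.cosh (a j) := fun j => by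
    rw [show (Finset.univ : Finset ℤˣ) = {1, -1} from rfl, Finset.sum_pair (by decide),
      Real.cosh_eq]
    simp
    ring
  rw [h1, Finset.prod_congr rfl fun j _ => h2 j, Finset.prod_mul_distrib, Finset.sum_div,
    Real.exp_sum]
  simp only [Finset.prod_const, Finset.card_univ, Fintype.card_fin]
  gcongr with j
  exact Real.cosh_le_exp_half_sq _

theorem sum_signs_exp_abs_le (N : ℕ) (a : Fin N → ℝ) (ha : ∑ j, a j ^ 2 ≤ 1) :
    ∑ ε : Fin N → ℤˣ, Real.exp (2 * |∑ j, ((ε j : ℤ) : ℝ) * a j|) ≤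
      2 ^ N * (2 * Real.exp 2) := by
  have h1 : ∀ b : Fin N → ℝ, (∑ j, b j ^ 2 ≤ 4) →
      ∑ ε : Fin N → ℤˣ, Real.exp (∑ j, ((ε j : ℤ) : ℝ) * b j) ≤ 2 ^ N * Real.exp 2 :=
    fun b hb => (sum_signs_exp_le N b).trans (by gcongr; linarith)
  have h2 := h1 (fun j => 2 * a j) (by simp only [mul_pow, ← Finset.mul_sum]; linarith)
  have h3 := h1 (fun j => -2 * a j) (by simp only [mul_pow, ← Finset.mul_sum]; linarith)
  calc _ ≤ ∑ ε : Fin N → ℤˣ, (Real.exp (∑ j, ((ε j : ℤ) : ℝ) * (2 * a j)) +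
        Real.exp (∑ j, ((ε j : ℤ) : ℝ) * (-2 * a j))) := by
        refine Finset.sum_le_sum fun ε _ => ?_
        have e1 : ∑ j, ((ε j : ℤ) : ℝ) * (2 * a j) = 2 * ∑ j, ((ε j : ℤ) : ℝ) * a j := by
          rw [Finset.mul_sum]; exact Finset.sum_congr rfl fun _ _ => by ring
        have e2 : ∑ j, ((ε j : ℤ) : ℝ) * (-2 * a j) = -(2 * ∑ j, ((ε j : ℤ) : ℝ) * a j) := by
          rw [Finset.mul_sum, ← Finset.sum_neg_distrib]
          exact Finset.sum_congr rfl fun _ _ => by ring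
        rw [e1, e2]
        have hp := fun x : ℝ => (Real.exp_pos x).le
        rcases abs_cases (∑ j, ((ε j : ℤ) : ℝ) * a j) with ⟨h, _⟩ | ⟨h, _⟩ <;> rw [h]
        · linarith [hp (-(2 * ∑ j, ((ε j : ℤ) : ℝ) * a j))]
        · rw [mul_neg]
          linarith [hp (2 * ∑ j, ((ε j : ℤ) : ℝ) * a j)]
    _ ≤ _ := by rw [Finset.sum_add_distrib]; linarith

theorem sum_signs_exp_norm_le (N : ℕ) (c : ℕ → 𝕜) (hc : ∑ j : Fin N, ‖c j‖ ^ 2 ≤ 1) :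
    ∑ ε : Fin N → ℤˣ, Real.exp ‖signSum 𝕜 c ε‖ ≤ 2 ^ N * (2 * Real.exp 2) := by
  have hsq : ∀ z : 𝕜, ‖z‖ ^ 2 = RCLike.re z ^ 2 + RCLike.im z ^ 2 := fun z => by
    rw [RCLike.norm_sq_eq_def]; ring
  have hre := sum_signs_exp_abs_le N (fun j => RCLike.re (c j))
    ((Finset.sum_le_sum fun j _ => by rw [hsq]; nlinarith [sq_nonneg (RCLike.im (c j))]).trans hc)
  have him := sum_signs_exp_abs_le N (fun j => RCLike.im (c j))
    ((Finset.sum_le_sum fun j _ => by rw [hsq]; nlinarith [sq_nonneg (RCLike.re (c j))]).trans hc)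
  have hr : ∀ ε : Fin N → ℤˣ,
      RCLike.re (signSum 𝕜 c ε) = ∑ j, ((ε j : ℤ) : ℝ) * RCLike.re (c j) := fun ε => by
    rw [signSum, map_sum]
    refine Finset.sum_congr rfl fun j _ => ?_
    rcases Int.units_eq_one_or (ε j) with h | h <;> simp [h]
  have hi : ∀ ε : Fin N → ℤˣ,
      RCLike.im (signSum 𝕜 c ε) = ∑ j, ((ε j : ℤ) : ℝ) * RCLike.im (c j) := fun ε => by
    rw [signSum, map_sum]
    refine Finset.sum_congr rfl fun j _ => ?_
    rcases Int.units_eq_one_or (ε j) with h | h <;> simp [h]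
  have key : ∀ ε : Fin N → ℤˣ, Real.exp ‖signSum 𝕜 c ε‖ ≤
      (Real.exp (2 * |∑ j, ((ε j : ℤ) : ℝ) * RCLike.re (c j)|) +
      Real.exp (2 * |∑ j, ((ε j : ℤ) : ℝ) * RCLike.im (c j)|)) / 2 := fun ε => by
    rw [← hr, ← hi]
    have h0 : ‖signSum 𝕜 c ε‖ ≤
        |RCLike.re (signSum 𝕜 c ε)| + |RCLike.im (signSum 𝕜 c ε)| := by
      rw [← sq_le_sq₀ (norm_nonneg _) (by positivity), hsq, add_sq, sq_abs, sq_abs]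
      have := mul_nonneg (abs_nonneg (RCLike.re (signSum 𝕜 c ε)))
        (abs_nonneg (RCLike.im (signSum 𝕜 c ε)))
      linarith
    refine (Real.exp_le_exp.2 h0).trans ?_
    rw [Real.exp_add, two_mul, two_mul, Real.exp_add, Real.exp_add]
    nlinarith [sq_nonneg (Real.exp |RCLike.re (signSum 𝕜 c ε)| -
      Real.exp |RCLike.im (signSum 𝕜 c ε)|)]
  refine (Finset.sum_le_sum fun ε _ => key ε).trans ?_
  rw [← Finset.sum_div, Finset.sum_add_distrib]
  linarith

variable (𝕜) in
/-- Khintchine's inequality, the upper bound for every moment. -/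
theorem exists_khintchine (q : ℝ) (hq : 0 ≤ q) : ∃ κ : ℝ, 0 ≤ κ ∧ ∀ (N : ℕ) (c : ℕ → 𝕜),
    ∑ j : Fin N, ‖c j‖ ^ 2 ≤ 1 →
      ∑ ε : Fin N → ℤˣ, ‖signSum 𝕜 c ε‖ ^ q ≤ 2 ^ N * κ := by
  obtain ⟨C, hC, h⟩ := rpow_le_const_mul_exp q one_pos hq
  refine ⟨C * (2 * Real.exp 2), by positivity, fun N c hc => ?_⟩
  calc _ ≤ ∑ ε : Fin N → ℤˣ, C * Real.exp ‖signSum 𝕜 c ε‖ :=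
        Finset.sum_le_sum fun ε _ => by simpa using h _ (norm_nonneg (signSum 𝕜 c ε))
    _ ≤ C * (2 ^ N * (2 * Real.exp 2)) := by
        rw [← Finset.mul_sum]
        gcongr
        exact sum_signs_exp_norm_le N c hc
    _ = _ := by ring

end Signs

/-! ### Tails and moments of Rademacher sums -/

section Tails

variable {𝕜 : Type*} [RCLike 𝕜] {E : Type*} [NormedAddCommGroup E] [NormedSpace 𝕜 E]

open Classical in
/-- The probability that one of the partial sums `a + ∑_{j < k} ε_j x_j`, `k ≤ N`, has norm
greater than `u`, computed by conditioning on the first sign. -/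
noncomputable def exceedProb (u : ℝ) : ℕ → (ℕ → E) → E → ℝ
  | 0, _, a => if u < ‖a‖ then 1 else 0
  | N + 1, x, a => if u < ‖a‖ then 1 else
      (exceedProb u N (fun j => x (j + 1)) (a + x 0) +
        exceedProb u N (fun j => x (j + 1)) (a - x 0)) / 2

theorem exceedProb_of_lt {u : ℝ} (N : ℕ) (x : ℕ → E) {a : E} (h : u < ‖a‖) :
    exceedProb u N x a = 1 := by
  cases N <;> simp [exceedProb, h]

theorem exceedProb_zero_of_le {u : ℝ} (x : ℕ → E) {a : E} (h : ‖a‖ ≤ u) :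
    exceedProb u 0 x a = 0 := by
  simp [exceedProb, h.not_gt]

theorem exceedProb_succ_of_le {u : ℝ} (N : ℕ) (x : ℕ → E) {a : E} (h : ‖a‖ ≤ u) :
    exceedProb u (N + 1) x a = (exceedProb u N (fun j => x (j + 1)) (a + x 0) +
        exceedProb u N (fun j => x (j + 1)) (a - x 0)) / 2 := by
  simp [exceedProb, h.not_gt]

theorem exceedProb_nonneg (u : ℝ) (N : ℕ) (x : ℕ → E) (a : E) : 0 ≤ exceedProb u N x a := by
  induction N generalizing x a with
  | zero => rw [exceedProb]; split_ifs <;> norm_num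
  | succ N ih =>
    rw [exceedProb]
    split_ifs
    · norm_num
    · have := ih (fun j => x (j + 1)) (a + x 0)
      have := ih (fun j => x (j + 1)) (a - x 0)
      positivity

theorem exceedProb_le_one (u : ℝ) (N : ℕ) (x : ℕ → E) (a : E) : exceedProb u N x a ≤ 1 := by
  induction N generalizing x a with
  | zero => rw [exceedProb]; split_ifs <;> norm_num
  | succ N ih =>
    rw [exceedProb]
    split_ifs
    · norm_num
    · have := ih (fun j => x (j + 1)) (a + x 0)
      have := ih (fun j => x (j + 1)) (a - x 0)
      linarith

theorem exceedProb_mono {u v : ℝ} (N : ℕ) (x : ℕ → E) {a b : E} (h : ‖b - a‖ ≤ v - u) :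
    exceedProb v N x b ≤ exceedProb u N x a := by
  induction N generalizing x a b with
  | zero =>
    rcases lt_or_ge u ‖a‖ with ha | ha
    · rw [exceedProb_of_lt _ _ ha]; exact exceedProb_le_one _ _ _ _
    · have := norm_sub_norm_le b a
      rw [exceedProb_zero_of_le x (by linarith : ‖b‖ ≤ v)]
      exact exceedProb_nonneg _ _ _ _
  | succ N ih =>
    rcases lt_or_ge u ‖a‖ with ha | ha
    · rw [exceedProb_of_lt _ _ ha]; exact exceedProb_le_one _ _ _ _
    · have := norm_sub_norm_le b a
      rw [exceedProb_succ_of_le N x (by linarith : ‖b‖ ≤ v), exceedProb_succ_of_le N x ha]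
      have h1 := ih (fun j => x (j + 1)) (a := a + x 0) (b := b + x 0) (by simpa using h)
      have h2 := ih (fun j => x (j + 1)) (a := a - x 0) (b := b - x 0) (by simpa using h)
      linarith

/-- An increment of norm greater than `2 s` has an endpoint of norm greater than `s`. -/
theorem exceedProb_shift_le (s : ℝ) (k N : ℕ) (x : ℕ → E) (a : E) :
    exceedProb (2 * s) N (fun j => x (j + k)) 0 ≤ exceedProb s (N + k) x a := by
  induction k generalizing x a with
  | zero =>
    rcases lt_or_ge s ‖a‖ with ha | ha
    · rw [exceedProb_of_lt _ _ ha]; exact exceedProb_le_one _ _ _ _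
    · exact exceedProb_mono N x (by simpa using by linarith)
  | succ k ih =>
    rcases lt_or_ge s ‖a‖ with ha | ha
    · rw [exceedProb_of_lt _ _ ha]; exact exceedProb_le_one _ _ _ _
    · rw [← add_assoc N k 1, exceedProb_succ_of_le (N + k) x ha]
      have h1 : exceedProb (2 * s) N (fun j => x (j + (k + 1))) 0 ≤ _ :=
        ih (fun j => x (j + 1)) (a + x 0)
      have h2 : exceedProb (2 * s) N (fun j => x (j + (k + 1))) 0 ≤ _ :=
        ih (fun j => x (j + 1)) (a - x 0)
      linarith

/-- A sum that goes beyond `u + c + 2 s` first passes `u`, where its norm is at most `u + c`, and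
from there, independently of the past, increases by more than `2 s`. -/
theorem exceedProb_add_le {u c s δ : ℝ} (hs : 0 ≤ s) (N : ℕ) (x : ℕ → E) (a : E)
    (hx : ∀ j, ‖x j‖ ≤ c) (hδ : ∀ k M, exceedProb (2 * s) M (fun j => x (j + k)) 0 ≤ δ)
    (ha : ‖a‖ ≤ u + c) :
    exceedProb (u + c + 2 * s) N x a ≤ δ * exceedProb u N x a := by
  induction N generalizing x a with
  | zero =>
    rw [exceedProb_zero_of_le x (by linarith)]
    exact mul_nonneg ((exceedProb_nonneg _ _ _ _).trans (hδ 0 0)) (exceedProb_nonneg _ _ _ _)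
  | succ N ih =>
    rcases lt_or_ge u ‖a‖ with h | h
    · rw [exceedProb_of_lt _ _ h, mul_one]
      exact (exceedProb_mono (a := 0) _ _ (by simpa using by linarith)).trans (hδ 0 (N + 1))
    · rw [exceedProb_succ_of_le N x h, exceedProb_succ_of_le N x (by linarith [norm_nonneg (x 0), hx 0])]
      have hδ' : ∀ k M, exceedProb (2 * s) M (fun j => x (j + k + 1)) 0 ≤ δ := fun k M =>
        hδ (k + 1) M
      have h1 := ih (fun j => x (j + 1)) (a + x 0) (fun j => hx _) hδ'
        ((norm_add_le _ _).trans (add_le_add h (hx 0)))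
      have h2 := ih (fun j => x (j + 1)) (a - x 0) (fun j => hx _) hδ'
        ((norm_sub_le _ _).trans (add_le_add h (hx 0)))
      linarith

theorem exceedProb_geometric {c s δ : ℝ} (hs : 0 ≤ s) (hc : 0 ≤ c) (x : ℕ → E)
    (hx : ∀ j, ‖x j‖ ≤ c) (hδ : ∀ N, exceedProb s N x 0 ≤ δ) (k N : ℕ) :
    exceedProb (s + k * (c + 2 * s)) N x 0 ≤ δ ^ (k + 1) := by
  have hδ0 : 0 ≤ δ := (exceedProb_nonneg _ _ _ _).trans (hδ 0)
  induction k with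
  | zero => simpa using hδ N
  | succ k ih =>
    have h := exceedProb_add_le (u := s + k * (c + 2 * s)) (δ := δ) hs N x 0 hx
      (fun k M => (exceedProb_shift_le s k M x 0).trans (hδ _))
      (by rw [norm_zero]; positivity)
    rw [show s + k * (c + 2 * s) + c + 2 * s = s + ((k + 1 : ℕ) : ℝ) * (c + 2 * s) by
      push_cast; ring] at h
    rw [pow_succ']
    exact h.trans (by gcongr)

theorem signSum_cons {N : ℕ} (x : ℕ → E) (e : ℤˣ) (ε : Fin N → ℤˣ) :
    signSum 𝕜 x (Fin.cons e ε : Fin (N + 1) → ℤˣ) =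
      ((e : ℤ) : 𝕜) • x 0 + signSum 𝕜 (fun j => x (j + 1)) ε := by
  simp [signSum, Fin.sum_univ_succ]

open Classical in
theorem card_lt_norm_signSum_le (u : ℝ) (N : ℕ) (x : ℕ → E) (a : E) :
    ∑ ε : Fin N → ℤˣ, (if u < ‖a + signSum 𝕜 x ε‖ then (1 : ℝ) else 0) ≤
      2 ^ N * exceedProb u N x a := by
  induction N generalizing x a with
  | zero => simp [signSum, exceedProb]
  | succ N ih =>
    rcases lt_or_ge u ‖a‖ with h | h
    · rw [exceedProb_of_lt _ _ h]
      refine (Finset.sum_le_sum (g := fun _ => (1 : ℝ)) fun ε _ => ?_).trans (by simp)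
      split_ifs <;> norm_num
    · rw [exceedProb_succ_of_le N x h, sum_signs_succ]
      have h1 := ih (fun j => x (j + 1)) (a + x 0)
      have h2 := ih (fun j => x (j + 1)) (a - x 0)
      simp only [signSum_cons, Units.val_one, Units.val_neg, Int.cast_one, Int.cast_neg, one_smul,
        neg_smul, ← add_assoc, ← sub_eq_add_neg]
      rw [pow_succ]
      linarith

variable (𝕜) in
/-- Sums that stay below `s` with probability at least `1 / 2`, uniformly in their length, have
exponential tails, hence moments of every order, bounded uniformly in their length. -/
theorem exists_moment_bound_of_exceedProb (x : ℕ → E) {s : ℝ} (hs : 0 < s)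
    (h : ∀ N, exceedProb s N x 0 ≤ 1 / 2) (r : ℝ) (hr : 0 ≤ r) :
    ∃ K : ℝ, 0 ≤ K ∧ ∀ N, ∑ ε : Fin N → ℤˣ, ‖signSum 𝕜 x ε‖ ^ r ≤ 2 ^ N * K := by
  classical
  -- A term of norm greater than `2 s` would force a partial sum to exceed `s`.
  have hx : ∀ j, ‖x j‖ ≤ 2 * s := fun j => by
    by_contra! hj
    have h1 := (exceedProb_shift_le s j 1 x 0).trans (h _)
    rw [exceedProb_succ_of_le 0 _ (by rw [norm_zero]; positivity), exceedProb_of_lt _ _ (by simpa),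
      exceedProb_of_lt _ _ (by simpa)] at h1
    norm_num at h1
  set l := 4 * s with hl
  have hl0 : 0 < l := by positivity
  -- The rate is such that `exp (lam * l) = 3 / 2`, so that the geometric series below converges.
  set lam := Real.log (3 / 2) / l with hlam
  have hlam0 : 0 < lam := div_pos (Real.log_pos (by norm_num)) hl0
  have hexp : ∀ k : ℕ, Real.exp (lam * (k * l)) = (3 / 2) ^ k := fun k => by
    rw [show lam * (k * l) = k * Real.log (3 / 2) by rw [hlam]; field_simp, Real.exp_nat_mul,
      Real.exp_log (by norm_num)]
  obtain ⟨C, hC, hCr⟩ := rpow_le_const_mul_exp r hlam0 hr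
  refine ⟨C * 6, by positivity, fun N => ?_⟩
  set v : (Fin N → ℤˣ) → ℝ := fun ε => ‖signSum 𝕜 x ε‖ with hv
  have hv0 : ∀ ε, 0 ≤ v ε := fun ε => norm_nonneg _
  have hcount : ∀ k : ℕ,
      ∑ ε : Fin N → ℤˣ, (if k * l ≤ v ε then (1 : ℝ) else 0) ≤ 2 ^ N * (1 / 2) ^ k := by
    intro k
    rcases k with _ | k
    · simp [hv0]
    · refine (Finset.sum_le_sum fun ε _ => ?_).trans
        ((card_lt_norm_signSum_le (𝕜 := 𝕜) (s + k * (2 * s + 2 * s)) N x 0).trans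
          (mul_le_mul_of_nonneg_left
            (exceedProb_geometric hs.le (by positivity) x hx h k N) (by positivity)))
      rw [zero_add]
      split_ifs with h1 h2 h2
      · rfl
      · refine absurd (lt_of_lt_of_le ?_ h1) h2
        push_cast
        nlinarith
      · norm_num
      · rfl
  obtain ⟨M, hM⟩ : ∃ M : ℕ, ∀ ε, ⌊v ε / l⌋₊ < M :=
    ⟨∑ ε, ⌊v ε / l⌋₊ + 1, fun ε => Nat.lt_succ_of_le
      (Finset.single_le_sum (f := fun ε => ⌊v ε / l⌋₊) (fun _ _ => Nat.zero_le _)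
        (Finset.mem_univ ε))⟩
  have hlevel : ∀ ε, Real.exp (lam * v ε) ≤
      ∑ k ∈ Finset.range M, (3 / 2 : ℝ) ^ (k + 1) * (if k * l ≤ v ε then (1 : ℝ) else 0) := by
    intro ε
    set k := ⌊v ε / l⌋₊ with hk
    have h1 : k * l ≤ v ε := by
      rw [← le_div_iff₀ hl0]; exact Nat.floor_le (div_nonneg (hv0 ε) hl0.le)
    have h2 : v ε ≤ (k + 1 : ℕ) * l := by
      rw [← div_le_iff₀ hl0]; push_cast; exact (Nat.lt_floor_add_one _).le
    refine le_trans ?_ (Finset.single_le_sum (f := fun k : ℕ =>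
      (3 / 2 : ℝ) ^ (k + 1) * (if k * l ≤ v ε then (1 : ℝ) else 0))
      (fun k _ => by positivity) (Finset.mem_range.2 (hM ε)))
    rw [if_pos h1, mul_one, ← hexp]
    gcongr
  have hgeom : ∑ k ∈ Finset.range M, (3 / 2 : ℝ) ^ (k + 1) * (1 / 2) ^ k ≤ 6 := by
    have h1 : ∀ k : ℕ, (3 / 2 : ℝ) ^ (k + 1) * (1 / 2) ^ k = 3 / 2 * (3 / 4) ^ k := fun k => by
      rw [pow_succ', mul_assoc, ← mul_pow]; norm_num
    simp only [h1, ← Finset.mul_sum]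
    have := (summable_geometric_of_lt_one (r := (3 / 4 : ℝ)) (by norm_num)
      (by norm_num)).sum_le_tsum (Finset.range M) (fun _ _ => by positivity)
    rw [tsum_geometric_of_lt_one (by norm_num) (by norm_num)] at this
    norm_num at this ⊢
    linarith
  calc ∑ ε, v ε ^ r ≤ ∑ ε, C * Real.exp (lam * v ε) :=
        Finset.sum_le_sum fun ε _ => hCr _ (hv0 ε)
    _ ≤ ∑ ε, C * ∑ k ∈ Finset.range M,
          (3 / 2 : ℝ) ^ (k + 1) * (if k * l ≤ v ε then (1 : ℝ) else 0) := by
        gcongr with ε; exact hlevel ε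
    _ = C * ∑ k ∈ Finset.range M, (3 / 2 : ℝ) ^ (k + 1) *
          ∑ ε, (if k * l ≤ v ε then (1 : ℝ) else 0) := by
        rw [← Finset.mul_sum, Finset.sum_comm]; simp only [Finset.mul_sum]
    _ ≤ C * ∑ k ∈ Finset.range M, (3 / 2 : ℝ) ^ (k + 1) * (2 ^ N * (1 / 2) ^ k) := by
        gcongr with k; exact hcount k
    _ = 2 ^ N * (C * ∑ k ∈ Finset.range M, (3 / 2 : ℝ) ^ (k + 1) * (1 / 2) ^ k) := by
        simp only [Finset.mul_sum]
        exact Finset.sum_congr rfl fun _ _ => by ring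
    _ ≤ _ := by gcongr

end Tails

/-! ### Rademacher functions -/

section Rademacher

variable {𝕜 : Type*} [RCLike 𝕜] {E : Type*} [NormedAddCommGroup E] [NormedSpace 𝕜 E]

theorem measurable_rademacher (j : ℕ) : Measurable (rademacher j) := by
  have h : Measurable Real.sign := by
    unfold Real.sign
    exact Measurable.ite measurableSet_Iio measurable_const
      (Measurable.ite measurableSet_Ioi measurable_const measurable_const)
  exact h.comp (by fun_prop)

theorem rademacher_succ (j : ℕ) (t : ℝ) : rademacher (j + 1) t = rademacher j (2 * t) := by
  unfold rademacher
  congr 2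
  ring

theorem rademacher_sub_one (j : ℕ) (t : ℝ) : rademacher j (t - 1) = rademacher j t := by
  unfold rademacher
  rw [show 2 ^ (j + 1) * Real.pi * (t - 1) =
      2 ^ (j + 1) * Real.pi * t - (2 ^ j : ℕ) * (2 * Real.pi) by push_cast; ring,
    Real.sin_sub_nat_mul_two_pi]

theorem rademacher_zero_left {t : ℝ} (h : t ∈ Set.Ioo (0 : ℝ) (1 / 2)) : rademacher 0 t = 1 := by
  have hpi := Real.pi_pos
  exact Real.sign_of_pos (Real.sin_pos_of_pos_of_lt_pi (by have := h.1; positivity)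
    (by have := h.2; norm_num; nlinarith))

theorem rademacher_zero_right {t : ℝ} (h : t ∈ Set.Ioo (1 / 2 : ℝ) 1) : rademacher 0 t = -1 := by
  have hpi := Real.pi_pos
  refine Real.sign_of_neg ?_
  rw [← Real.sin_sub_two_pi]
  refine Real.sin_neg_of_neg_of_neg_pi_lt ?_ ?_
  · have := h.2; norm_num; nlinarith
  · have := h.1; norm_num; nlinarith

variable (𝕜) in
/-- The points at which one of the partial sums `a + ∑_{j < k} r_j x_j`, `k ≤ N`, has norm greater
than `u`. -/
def exceedSet (u : ℝ) (N : ℕ) (x : ℕ → E) (a : E) : Set ℝ :=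
  {t | ∃ k ≤ N, u < ‖a + ∑ j ∈ Finset.range k, (rademacher j t : 𝕜) • x j‖}

theorem measurableSet_exceedSet (u : ℝ) (N : ℕ) (x : ℕ → E) (a : E) :
    MeasurableSet (exceedSet 𝕜 u N x a) := by
  have h : exceedSet 𝕜 u N x a = ⋃ k ∈ Finset.range (N + 1),
      {t | u < ‖a + ∑ j ∈ Finset.range k, (rademacher j t : 𝕜) • x j‖} := by
    ext t; simp [exceedSet]
  rw [h]
  refine Finset.measurableSet_biUnion _ fun k _ => measurableSet_lt measurable_const ?_
  refine StronglyMeasurable.measurable (StronglyMeasurable.norm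
    (stronglyMeasurable_const.add (Finset.stronglyMeasurable_fun_sum _ fun j _ => ?_)))
  exact (RCLike.measurable_ofReal.comp (measurable_rademacher j)).stronglyMeasurable.smul_const _

theorem exceedSet_succ_of_sign {u : ℝ} {N : ℕ} {x : ℕ → E} {a : E} {t : ℝ}
    {y : E} (hy : (rademacher 0 t : 𝕜) • x 0 = y)
    (ht : 2 * t ∈ exceedSet 𝕜 u N (fun j => x (j + 1)) (a + y)) :
    t ∈ exceedSet 𝕜 u (N + 1) x a := by
  obtain ⟨k, hk, h⟩ := ht
  refine ⟨k + 1, by omega, ?_⟩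
  rw [Finset.sum_range_succ', hy]
  simp only [rademacher_succ]
  rwa [add_comm _ y, ← add_assoc]

theorem exceedSet_sub_one (u : ℝ) (N : ℕ) (x : ℕ → E) (a : E) (t : ℝ) :
    t - 1 ∈ exceedSet 𝕜 u N x a ↔ t ∈ exceedSet 𝕜 u N x a := by
  simp only [exceedSet, Set.mem_ofPred_eq, rademacher_sub_one]

variable (𝕜) in
/-- The Rademacher functions are distributed like independent signs: they are constant on the two
halves of `[0, 1]` for `j = 0`, and on each half the remaining ones are rescaled copies of the
whole sequence. -/
theorem exceedProb_le_volume {u : ℝ} (N : ℕ) (x : ℕ → E) (a : E) :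
    ENNReal.ofReal (exceedProb u N x a) ≤ volume (exceedSet 𝕜 u N x a ∩ Set.Ioo 0 1) := by
  have hbig : ∀ (N : ℕ) (x : ℕ → E) (a : E), u < ‖a‖ →
      ENNReal.ofReal (exceedProb u N x a) ≤ volume (exceedSet 𝕜 u N x a ∩ Set.Ioo 0 1) := by
    intro N x a h
    have h1 : exceedSet 𝕜 u N x a = Set.univ :=
      Set.eq_univ_of_forall fun t => ⟨0, Nat.zero_le _, by simpa⟩
    rw [exceedProb_of_lt N x h, h1]
    simp
  induction N generalizing x a with
  | zero =>
    rcases lt_or_ge u ‖a‖ with h | h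
    · exact hbig 0 x a h
    · simp [exceedProb_zero_of_le x h]
  | succ N ih =>
    rcases lt_or_ge u ‖a‖ with h | h
    · exact hbig _ x a h
    · rw [exceedProb_succ_of_le N x h]
      set A := exceedSet 𝕜 u N (fun j => x (j + 1)) (a + x 0) with hA
      set B := exceedSet 𝕜 u N (fun j => x (j + 1)) (a - x 0) with hB
      have hA2 : volume ((fun t : ℝ => 2 * t) ⁻¹' (A ∩ Set.Ioo 0 1)) =
          ENNReal.ofReal (1 / 2) * volume (A ∩ Set.Ioo 0 1) := by
        rw [Real.volume_preimage_mul_left two_ne_zero]; norm_num [abs_of_pos]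
      have hB2 : volume ((fun t : ℝ => t + (-1 / 2)) ⁻¹'
          ((fun t : ℝ => 2 * t) ⁻¹' (B ∩ Set.Ioo 0 1))) =
          ENNReal.ofReal (1 / 2) * volume (B ∩ Set.Ioo 0 1) := by
        rw [measure_preimage_add_right, Real.volume_preimage_mul_left two_ne_zero]
        norm_num [abs_of_pos]
      have hsplit : ENNReal.ofReal (1 / 2) * volume (A ∩ Set.Ioo 0 1) +
          ENNReal.ofReal (1 / 2) * volume (B ∩ Set.Ioo 0 1) ≤
          volume (exceedSet 𝕜 u (N + 1) x a ∩ Set.Ioo 0 1) := by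
        rw [← hA2, ← hB2, ← measure_union']
        · refine measure_mono ?_
          rintro t (⟨h1, h2, h3⟩ | ⟨h1, h2, h3⟩)
          · have ht : t ∈ Set.Ioo (0 : ℝ) (1 / 2) := ⟨by linarith, by linarith⟩
            exact ⟨exceedSet_succ_of_sign (y := x 0) (by simp [rademacher_zero_left ht]) h1,
              ht.1, by linarith [ht.2]⟩
          · have ht : t ∈ Set.Ioo (1 / 2 : ℝ) 1 := ⟨by linarith, by linarith⟩
            refine ⟨exceedSet_succ_of_sign (y := -x 0) (by simp [rademacher_zero_right ht]) ?_,
              by linarith [ht.1], ht.2⟩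
            rw [← exceedSet_sub_one, ← sub_eq_add_neg]
            convert h1 using 1
            ring
        · refine Set.disjoint_left.2 ?_
          rintro t ⟨_, _, h3⟩ ⟨_, h2, _⟩
          simp only at h2 h3
          linarith
        · exact ((measurableSet_exceedSet _ _ _ _).inter measurableSet_Ioo).preimage
            (measurable_const_mul 2)
      refine le_trans ?_ hsplit
      rw [← mul_add, add_div, div_eq_inv_mul, div_eq_inv_mul, ← mul_add,
        ENNReal.ofReal_mul (by norm_num), ← one_div,
        ENNReal.ofReal_add (exceedProb_nonneg _ _ _ _) (exceedProb_nonneg _ _ _ _)]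
      gcongr
      · exact ih _ _
      · exact ih _ _

/-- The partial sums of an almost unconditionally summable sequence are almost surely bounded,
hence bounded by a constant outside a set of small measure. -/
theorem exists_exceedProb_le_half {x : ℕ → E} (hx : x ∈ Rad 𝕜 E) :
    ∃ s : ℝ, 0 < s ∧ ∀ N, exceedProb s N x 0 ≤ 1 / 2 := by
  set T : ℕ → Set ℝ := fun s => ⋃ N, exceedSet 𝕜 (s + 1 : ℝ) N x 0 ∩ Set.Ioo 0 1 with hT
  have hmeas : ∀ s, MeasurableSet (T s) := fun s =>
    MeasurableSet.iUnion fun N => (measurableSet_exceedSet _ _ _ _).inter measurableSet_Ioo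
  have hanti : Antitone T := by
    intro s s' hs
    refine Set.iUnion_mono fun N => Set.inter_subset_inter_left _ ?_
    rintro t ⟨k, hk, h⟩
    refine ⟨k, hk, lt_of_le_of_lt ?_ h⟩
    gcongr
  have hsub : ∀ s, T s ⊆ Set.Ioo 0 1 := fun s => Set.iUnion_subset fun N => Set.inter_subset_right
  have hzero : volume (⋂ s, T s) = 0 := by
    have h0 := (ae_restrict_iff' measurableSet_Icc).1 hx
    refine measure_mono_null ?_ (ae_iff.1 h0)
    intro t ht h
    obtain ⟨y, hy⟩ := h (Set.Ioo_subset_Icc_self (hsub 0 (Set.mem_iInter.1 ht 0)))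
    obtain ⟨R, hR⟩ := hy.norm.bddAbove_range
    obtain ⟨N, ⟨k, _, hk⟩, _⟩ := Set.mem_iUnion.1 (Set.mem_iInter.1 ht ⌈R⌉₊)
    have h1 := hR ⟨k, rfl⟩
    rw [zero_add] at hk
    have h2 := Nat.le_ceil R
    simp only at h1
    linarith
  have hlim := tendsto_measure_iInter_atTop (μ := volume)
    (fun s => (hmeas s).nullMeasurableSet) hanti
    ⟨0, ((measure_mono (hsub 0)).trans_lt (by simp)).ne⟩
  rw [hzero] at hlim
  obtain ⟨s, hs⟩ := (hlim.eventually (gt_mem_nhds (show (0 : ℝ≥0∞) < ENNReal.ofReal (1 / 2) by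
    simp))).exists
  refine ⟨s + 1, by positivity, fun N => ?_⟩
  rw [← ENNReal.ofReal_le_ofReal_iff (by norm_num)]
  exact (exceedProb_le_volume 𝕜 N x 0).trans ((measure_mono
    (Set.subset_iUnion (fun N => exceedSet 𝕜 (s + 1 : ℝ) N x 0 ∩ Set.Ioo 0 1) N)).trans hs.le)

/-- Kahane's theorem for almost unconditionally summable sequences: all moments of the Rademacher
sums are bounded, uniformly in the length. -/
theorem exists_moment_bound_of_mem_Rad {x : ℕ → E} (hx : x ∈ Rad 𝕜 E) (r : ℝ) (hr : 0 ≤ r) :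
    ∃ K : ℝ, 0 ≤ K ∧ ∀ N, ∑ ε : Fin N → ℤˣ, ‖signSum 𝕜 x ε‖ ^ r ≤ 2 ^ N * K := by
  obtain ⟨s, hs, h⟩ := exists_exceedProb_le_half hx
  exact exists_moment_bound_of_exceedProb 𝕜 x hs h r hr

end Rademacher

/-! ### Uniform bounds for Cohen strongly summing operators -/

section Cohen

variable {𝕜 : Type*} [RCLike 𝕜] {F : Type*} [NormedAddCommGroup F] [NormedSpace 𝕜 F]

theorem weakNorm_le_one_iff {q : ℝ} (hq : 0 < q) (x : ℕ → F) :
    weakNorm 𝕜 q x ≤ 1 ↔ ∀ φ : StrongDual 𝕜 F, ‖φ‖ ≤ 1 → ∑' j, ‖φ (x j)‖ₑ ^ q ≤ 1 := by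
  simp only [weakNorm, iSup_le_iff]
  refine forall₂_congr fun φ _ => ?_
  rw [one_div, ENNReal.rpow_inv_le_iff hq, ENNReal.one_rpow]

theorem tsum_comp_extend {ι M : Type*} [Zero M] (e : ι → ℕ) (he : Function.Injective e)
    (φ : ι → M) (f : ℕ → M → ℝ≥0∞) (hf : ∀ j, f j 0 = 0) :
    ∑' j, f j (Function.extend e φ 0 j) = ∑' i, f (e i) (φ i) := by
  rw [← he.tsum_eq (f := fun j => f j (Function.extend e φ 0 j))]
  · simp only [he.extend_apply]
  · intro j hj
    by_contra h
    exact hj (by simp [Function.extend_apply' _ _ _ h, hf])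

/-- The Cohen norm dominates the pairings of any subfamily with a weakly summable family of
functionals. -/
theorem tsum_le_cohenNorm {ι : Type*} {p : ℝ} (hp : 1 < p) (e : ι → ℕ)
    (he : Function.Injective e) (x : ℕ → F) (φ : ι → StrongDual 𝕜 F)
    (hφ : ∀ y : StrongDual 𝕜 (StrongDual 𝕜 F), ‖y‖ ≤ 1 →
      ∑' i, ‖y (φ i)‖ₑ ^ (p / (p - 1)) ≤ 1) :
    ∑' i, ‖φ i (x (e i))‖ₑ ≤ cohenNorm 𝕜 p x := by
  have hq : 0 < p / (p - 1) := div_pos (by linarith) (by linarith)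
  have hw : weakNorm 𝕜 (p / (p - 1)) (Function.extend e φ 0) ≤ 1 := by
    rw [weakNorm_le_one_iff hq]
    intro y hy
    rw [tsum_comp_extend e he φ (fun _ ψ => ‖y ψ‖ₑ ^ (p / (p - 1))) (by simp [hq])]
    exact hφ y hy
  rw [← tsum_comp_extend e he φ (fun j ψ => ‖ψ (x j)‖ₑ) (by simp)]
  exact le_iSup₂_of_le (f := fun (ψ : ℕ → StrongDual 𝕜 F)
    (_ : weakNorm 𝕜 (p / (p - 1)) ψ ≤ 1) => ∑' j, ‖ψ j (x j)‖ₑ) _ hw le_rfl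

theorem mul_cohenNorm_le_of_injective {p : ℝ} (hp : 1 < p) (e : ℕ → ℕ)
    (he : Function.Injective e) (x y : ℕ → F) (c : 𝕜) (h : ∀ j, x (e j) = c • y j) :
    ‖c‖ₑ * cohenNorm 𝕜 p y ≤ cohenNorm 𝕜 p x := by
  have hq : 0 < p / (p - 1) := div_pos (by linarith) (by linarith)
  conv_lhs => rw [cohenNorm]
  simp only [ENNReal.mul_iSup]
  refine iSup₂_le fun φ hφ => ?_
  refine le_trans (le_of_eq ?_) (tsum_le_cohenNorm hp e he x φ ((weakNorm_le_one_iff hq φ).1 hφ))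
  simp only [h, map_smul, enorm_smul, ENNReal.tsum_mul_left]

variable {n : ℕ} {E : Fin n → Type*} [∀ m, NormedAddCommGroup (E m)] [∀ m, NormedSpace 𝕜 (E m)]

theorem enorm_rpow_eq_ofReal {G : Type*} [NormedAddCommGroup G] (x : G) {q : ℝ} (hq : 0 ≤ q) :
    ‖x‖ₑ ^ q = ENNReal.ofReal (‖x‖ ^ q) := by
  rw [← ofReal_norm, ENNReal.ofReal_rpow_of_nonneg (norm_nonneg _) hq]

/-- The defining condition of Cohen strongly summing operators holds with a uniform bound:
sequences in the unit ball with Cohen norms of the images growing fast could be scaled down and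
glued to a single sequence that violates the condition. -/
theorem IsCohenStronglySumming.exists_cohenNorm_le (hn : 1 ≤ n) {p : ℝ} (hp : 1 < p)
    {A : ContinuousMultilinearMap 𝕜 E F} (hA : IsCohenStronglySumming p A) :
    ∃ C : ℕ, ∀ x : ∀ m, ℕ → E m, (∀ m, ∑' j, ‖x m j‖ₑ ^ (n * p) ≤ 1) →
      cohenNorm 𝕜 p (fun j => A fun m => x m j) ≤ C := by
  by_contra! hcon
  choose x hx hlarge using fun k : ℕ => hcon ((2 ^ n) ^ k * k)
  have hn' : (1 : ℝ) ≤ n := by exact_mod_cast hn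
  have hnp : 1 ≤ n * p := by nlinarith
  set y : ∀ m, ℕ → E m := fun m j =>
    ((2 : 𝕜)⁻¹ ^ (Nat.unpair j).1) • x (Nat.unpair j).1 m (Nat.unpair j).2 with hy
  have h2 : ‖(2 : 𝕜)⁻¹‖ₑ = 2⁻¹ := by
    rw [enorm_inv two_ne_zero]
    congr 1
    rw [← ofReal_norm, RCLike.norm_ofNat]
    simp
  have hysum : ∀ m, ∑' j, ‖y m j‖ₑ ^ (n * p) ≠ ∞ := by
    intro m
    have h1 : ∑' j, ‖y m j‖ₑ ^ (n * p) ≤ 2 := by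
      rw [← Nat.pairEquiv.tsum_eq,
        ENNReal.tsum_prod (f := fun k l => ‖y m (Nat.pairEquiv (k, l))‖ₑ ^ (n * p)), ← ENNReal.tsum_geometric_two]
      refine ENNReal.tsum_le_tsum fun k => ?_
      have h3 : ∀ l, ‖y m (Nat.pairEquiv (k, l))‖ₑ ^ (n * p) =
          ((2⁻¹ : ℝ≥0∞) ^ k) ^ (n * p) * ‖x k m l‖ₑ ^ (n * p) := fun l => by
        simp only [hy, Nat.pairEquiv_apply, Function.uncurry_apply_pair, Nat.unpair_pair,
          enorm_smul, enorm_pow, h2]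
        rw [ENNReal.mul_rpow_of_nonneg _ _ (by linarith)]
      simp only [h3, ENNReal.tsum_mul_left]
      calc _ ≤ ((2⁻¹ : ℝ≥0∞) ^ k) ^ (n * p) * 1 := by gcongr; exact hx k m
        _ ≤ ((2⁻¹ : ℝ≥0∞) ^ k) ^ (1 : ℝ) := by
          rw [mul_one]
          exact ENNReal.rpow_le_rpow_of_exponent_ge (pow_le_one₀ (by simp) (by simp)) hnp
        _ = _ := by rw [ENNReal.rpow_one]
    exact (h1.trans_lt (by simp)).ne
  have hfin : cohenNorm 𝕜 p (fun j => A fun m => y m j) < ∞ := by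
    refine hA y fun m => ?_
    have h1 := hysum m
    simp only [enorm_rpow_eq_ofReal _ (zero_le_one.trans hnp)] at h1
    have h3 := ENNReal.summable_toReal h1
    refine h3.congr fun j => ?_
    rw [ENNReal.toReal_ofReal (by positivity)]
  have hk : ∀ k : ℕ, (k : ℝ≥0∞) ≤ cohenNorm 𝕜 p (fun j => A fun m => y m j) := by
    intro k
    refine le_trans ?_ (mul_cohenNorm_le_of_injective hp (Nat.pair k)
      (fun a b h => (Nat.pair_eq_pair.1 h).2) _ (fun j => A fun m => x k m j)
      (((2 : 𝕜)⁻¹ ^ k) ^ n) fun j => ?_)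
    · calc (k : ℝ≥0∞) = ‖((2 : 𝕜)⁻¹ ^ k) ^ n‖ₑ * (((2 ^ n) ^ k * k : ℕ) : ℝ≥0∞) := by
            rw [enorm_pow, enorm_pow, h2]
            push_cast
            rw [← mul_assoc, ← pow_mul, ← pow_mul, mul_comm n k, ← mul_pow,
              ENNReal.inv_mul_cancel (by simp) (by simp), one_pow, one_mul]
        _ ≤ _ := by gcongr; exact (hlarge k).le
    · simp only [hy, Nat.unpair_pair]
      rw [A.map_smul_univ (fun _ => (2 : 𝕜)⁻¹ ^ k)]
      simp
  obtain ⟨k, hk'⟩ := ENNReal.exists_nat_gt hfin.ne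
  exact absurd (hk k) hk'.not_ge

/-- The inequality that characterizes Cohen strongly summing operators, for finite families. -/
theorem IsCohenStronglySumming.exists_finite_bound (hn : 1 ≤ n) {p : ℝ} (hp : 1 < p)
    {A : ContinuousMultilinearMap 𝕜 E F} (hA : IsCohenStronglySumming p A) :
    ∃ C : ℝ, 0 ≤ C ∧ ∀ (ι : Type) [Fintype ι] (x : ∀ m, ι → E m) (φ : ι → StrongDual 𝕜 F)
      (b : Fin n → ℝ) (d : ℝ), (∀ m, 0 ≤ b m) → 0 ≤ d →
      (∀ m, ∑ i, ‖x m i‖ ^ (n * p) ≤ b m ^ (n * p)) →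
      (∀ y : StrongDual 𝕜 (StrongDual 𝕜 F), ‖y‖ ≤ 1 →
        ∑ i, ‖y (φ i)‖ ^ (p / (p - 1)) ≤ d ^ (p / (p - 1))) →
      ∑ i, ‖φ i (A fun m => x m i)‖ ≤ C * d * ∏ m, b m := by
  obtain ⟨C, hC⟩ := hA.exists_cohenNorm_le hn hp
  have hq : 0 < p / (p - 1) := div_pos (by linarith) (by linarith)
  have hn' : (1 : ℝ) ≤ n := by exact_mod_cast hn
  have hnp : 0 < n * p := by nlinarith
  refine ⟨C, by positivity, fun ι _ x φ b d hb hd hx hφ => ?_⟩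
  -- The inequality for norms at most one; the general one follows by scaling, which needs
  -- positive bounds, and a passage to the limit.
  have hunit : ∀ (x : ∀ m, ι → E m) (φ : ι → StrongDual 𝕜 F),
      (∀ m, ∑ i, ‖x m i‖ ^ (n * p) ≤ 1) →
      (∀ y : StrongDual 𝕜 (StrongDual 𝕜 F), ‖y‖ ≤ 1 → ∑ i, ‖y (φ i)‖ ^ (p / (p - 1)) ≤ 1) →
      ∑ i, ‖φ i (A fun m => x m i)‖ ≤ C := by
    intro x φ hx hφ
    set e : ι → ℕ := fun i => Fintype.equivFin ι i with he
    have hinj : Function.Injective e := Fin.val_injective.comp (Fintype.equivFin ι).injective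
    have h1 := hC (fun m => Function.extend e (x m) 0) fun m => by
      rw [tsum_comp_extend e hinj (x m) (fun _ v => ‖v‖ₑ ^ (n * p)) (by simp [hnp]),
        tsum_fintype]
      simp only [enorm_rpow_eq_ofReal _ hnp.le]
      rw [← ENNReal.ofReal_sum_of_nonneg fun _ _ => by positivity, ← ENNReal.ofReal_one]
      exact ENNReal.ofReal_le_ofReal (hx m)
    have h2 := (tsum_le_cohenNorm hp e hinj _ φ fun y hy => by
      rw [tsum_fintype]
      simp only [enorm_rpow_eq_ofReal _ hq.le]
      rw [← ENNReal.ofReal_sum_of_nonneg fun _ _ => by positivity, ← ENNReal.ofReal_one]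
      exact ENNReal.ofReal_le_ofReal (hφ y hy)).trans h1
    simp only [hinj.extend_apply, tsum_fintype, ← ofReal_norm] at h2
    rw [← ENNReal.ofReal_sum_of_nonneg fun _ _ => norm_nonneg _,
      ENNReal.ofReal_le_natCast] at h2
    exact h2
  have hpos : ∀ t : ℝ, 0 < t →
      ∑ i, ‖φ i (A fun m => x m i)‖ ≤ C * (d + t) * ∏ m, (b m + t) := by
    intro t ht
    have hd' : 0 < d + t := by linarith
    have hb' : ∀ m, 0 < b m + t := fun m => by linarith [hb m]
    have key := hunit (fun m i => (((b m + t)⁻¹ : ℝ) : 𝕜) • x m i)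
      (fun i => (((d + t)⁻¹ : ℝ) : 𝕜) • φ i) (fun m => by
        simp only [norm_smul, RCLike.norm_ofReal, abs_inv, abs_of_pos (hb' m)]
        simp only [Real.mul_rpow (inv_nonneg.2 (hb' m).le) (norm_nonneg _), ← Finset.mul_sum]
        rw [Real.inv_rpow (hb' m).le, inv_mul_le_one₀ (Real.rpow_pos_of_pos (hb' m) _)]
        exact (hx m).trans (Real.rpow_le_rpow (hb m) (by linarith) hnp.le))
      (fun y hy => by
        simp only [map_smul, norm_smul, RCLike.norm_ofReal, abs_inv, abs_of_pos hd']
        simp only [Real.mul_rpow (inv_nonneg.2 hd'.le) (norm_nonneg _), ← Finset.mul_sum]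
        rw [Real.inv_rpow hd'.le, inv_mul_le_one₀ (Real.rpow_pos_of_pos hd' _)]
        exact (hφ y hy).trans (Real.rpow_le_rpow hd (by linarith) hq.le))
    have hAs : ∀ i, A (fun m => (((b m + t)⁻¹ : ℝ) : 𝕜) • x m i) =
        (∏ m, (((b m + t)⁻¹ : ℝ) : 𝕜)) • A fun m => x m i := fun i =>
      A.map_smul_univ (fun m => (((b m + t)⁻¹ : ℝ) : 𝕜)) (fun m => x m i)
    simp only [hAs, map_smul, smul_apply, norm_smul, norm_prod,
      RCLike.norm_ofReal, abs_inv, abs_of_pos hd', abs_of_pos (hb' _), Finset.prod_inv_distrib,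
      ← Finset.mul_sum] at key
    rw [inv_mul_le_iff₀ (Finset.prod_pos fun m _ => hb' m), inv_mul_le_iff₀ hd'] at key
    linarith
  have hlim : Tendsto (fun t : ℝ => C * (d + t) * ∏ m, (b m + t)) (𝓝[>] 0)
      (𝓝 (C * (d + 0) * ∏ m, (b m + 0))) :=
    (Continuous.tendsto (f := fun t : ℝ => C * (d + t) * ∏ m, (b m + t))
      (by fun_prop) 0).mono_left nhdsWithin_le_nhds
  simp only [add_zero] at hlim
  exact ge_of_tendsto hlim (eventually_nhdsWithin_of_forall hpos)

end Cohen

/-! ### Averages of Cohen's inequality -/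

section Averages

variable {𝕜 : Type*} [RCLike 𝕜] {n : ℕ}
  {E : Fin n → Type*} [∀ m, NormedAddCommGroup (E m)] [∀ m, NormedSpace 𝕜 (E m)]
  {F : Type*} [NormedAddCommGroup F] [NormedSpace 𝕜 F]

/-- Cohen's inequality in the variable `i`, the other variables `z` being fixed, for families
indexed by a space of signs and with sums normalized to averages: the average of
`‖φ (A (z, x))‖` is at most `K` times the weak `L_q` norm `d` of `φ`, the `L_r` norm `b` of `x`
and the norms of the other variables. -/
def IsAverageBounded (A : ContinuousMultilinearMap 𝕜 E F) (i : Fin n) (r q K : ℝ) : Prop :=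
  ∀ (N : ℕ) (z : ∀ m, E m) (x : (Fin N → ℤˣ) → E i) (φ : (Fin N → ℤˣ) → StrongDual 𝕜 F)
    (b d : ℝ), 0 ≤ b → 0 ≤ d → ∑ ε, ‖x ε‖ ^ r ≤ 2 ^ N * b ^ r →
    (∀ y : StrongDual 𝕜 (StrongDual 𝕜 F), ‖y‖ ≤ 1 → ∑ ε, ‖y (φ ε)‖ ^ q ≤ 2 ^ N * d ^ q) →
    ∑ ε, ‖φ ε (A (Function.update z i (x ε)))‖ ≤
      2 ^ N * (K * d * b * ∏ m ∈ Finset.univ.erase i, ‖z m‖)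

theorem mul_rpow_eq_rpow_mul {a b r : ℝ} (ha : 0 ≤ a) (hb : 0 ≤ b) (hr : r ≠ 0) :
    (a ^ (1 / r) * b) ^ r = a * b ^ r := by
  rw [Real.mul_rpow (by positivity) hb, ← Real.rpow_mul ha, one_div_mul_cancel hr, Real.rpow_one]

theorem IsCohenStronglySumming.exists_isAverageBounded (hn : 1 ≤ n) {p : ℝ} (hp : 1 < p)
    {A : ContinuousMultilinearMap 𝕜 E F} (hA : IsCohenStronglySumming p A) (i : Fin n) :
    ∃ K : ℝ, 0 ≤ K ∧ IsAverageBounded A i (n * p) (p / (p - 1)) K := by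
  obtain ⟨C, hC, h⟩ := hA.exists_finite_bound hn hp
  refine ⟨C, hC, fun N z x φ b d hb hd hx hφ => ?_⟩
  have hn' : (1 : ℝ) ≤ n := by exact_mod_cast hn
  have hnp : (n : ℝ) * p ≠ 0 := by positivity
  have hq : p / (p - 1) ≠ 0 := (div_pos (by linarith) (by linarith)).ne'
  have h2 : (0 : ℝ) ≤ 2 ^ N := by positivity
  have key := h (Fin N → ℤˣ) (fun m ε => Function.update z i (x ε) m) φ
    (fun m => (2 ^ N : ℝ) ^ (1 / (n * p)) * Function.update (fun m => ‖z m‖) i b m)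
    ((2 ^ N : ℝ) ^ (1 / (p / (p - 1))) * d)
    (fun m => by
      refine mul_nonneg (by positivity) ?_
      by_cases hm : m = i
      · subst hm; simpa using hb
      · simp [hm])
    (by positivity)
    (fun m => by
      by_cases hm : m = i
      · subst hm
        simp only [Function.update_self]
        rwa [mul_rpow_eq_rpow_mul h2 hb hnp]
      · simp only [Function.update_of_ne hm]
        rw [mul_rpow_eq_rpow_mul h2 (norm_nonneg _) hnp]
        simp)
    (fun y hy => by
      rw [mul_rpow_eq_rpow_mul h2 hd hq]
      exact hφ y hy)
  refine key.trans (le_of_eq ?_)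
  rw [Finset.prod_mul_distrib, Finset.prod_const, Finset.card_univ, Fintype.card_fin,
    Finset.prod_update_of_mem (Finset.mem_univ i), ← Finset.erase_eq,
    ← Real.rpow_mul_natCast h2]
  have e1 : (1 / (n * p) * (n : ℝ)) = 1 / p := by
    have : (n : ℝ) ≠ 0 := by positivity
    field_simp
  -- The normalizing factors multiply to `2 ^ N`, as `1 / p` and `(p - 1) / p` add up to `1`.
  have e2 : (2 ^ N : ℝ) ^ (1 / (p / (p - 1))) * (2 ^ N : ℝ) ^ (1 / p) = 2 ^ N := by
    rw [← Real.rpow_add (by positivity)]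
    convert Real.rpow_one _ using 2
    field_simp
    ring
  rw [e1]
  calc _ = ((2 ^ N : ℝ) ^ (1 / (p / (p - 1))) * (2 ^ N : ℝ) ^ (1 / p)) *
      (C * d * b * ∏ m ∈ Finset.univ.erase i, ‖z m‖) := by ring
    _ = _ := by rw [e2]

/-- Cohen strongly summing linear operators are the multilinear ones in a single variable. -/
theorem IsCohenStronglySummingLinear.exists_isAverageBounded {E F : Type*} [NormedAddCommGroup E]
    [NormedSpace 𝕜 E] [NormedAddCommGroup F] [NormedSpace 𝕜 F] {p : ℝ} (hp : 1 < p)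
    {u : E →L[𝕜] F} (hu : IsCohenStronglySummingLinear p u) :
    ∃ K : ℝ, 0 ≤ K ∧ ∀ (N : ℕ) (x : (Fin N → ℤˣ) → E) (φ : (Fin N → ℤˣ) → StrongDual 𝕜 F)
      (b d : ℝ), 0 ≤ b → 0 ≤ d → ∑ ε, ‖x ε‖ ^ p ≤ 2 ^ N * b ^ p →
      (∀ y : StrongDual 𝕜 (StrongDual 𝕜 F), ‖y‖ ≤ 1 →
        ∑ ε, ‖y (φ ε)‖ ^ (p / (p - 1)) ≤ 2 ^ N * d ^ (p / (p - 1))) →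
      ∑ ε, ‖φ ε (u (x ε))‖ ≤ 2 ^ N * (K * d * b) := by
  have hA : IsCohenStronglySumming p
      (ContinuousMultilinearMap.ofSubsingleton 𝕜 E F (0 : Fin 1) u) := by
    intro x hx
    have := hx 0
    simp only [Nat.cast_one, one_mul] at this
    exact hu (x 0) this
  obtain ⟨K, hK, h⟩ := hA.exists_isAverageBounded le_rfl hp 0
  refine ⟨K, hK, fun N x φ b d hb hd hx hφ => ?_⟩
  simpa using h N 0 x φ b d hb hd (by simpa using hx) hφ

theorem sum_norm_rpow_le_of_weak {ι : Type*} [Fintype ι] {q M : ℝ} (hq : 0 < q)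
    {φ : ι → F} (hφ : ∀ y : StrongDual 𝕜 F, ‖y‖ ≤ 1 → ∑ i, ‖y (φ i)‖ ^ q ≤ M)
    (y : StrongDual 𝕜 F) : ∑ i, ‖y (φ i)‖ ^ q ≤ M * ‖y‖ ^ q := by
  rcases eq_or_ne y 0 with rfl | hy
  · simp [hq.ne']
  · have hy' : 0 < ‖y‖ := norm_pos_iff.2 hy
    have h := hφ (((‖y‖⁻¹ : ℝ) : 𝕜) • y) (by
      rw [norm_smul, RCLike.norm_ofReal, abs_inv, abs_norm, inv_mul_cancel₀ hy'.ne'])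
    simp only [smul_apply, norm_smul, RCLike.norm_ofReal, abs_inv, abs_norm] at h
    simp only [Real.mul_rpow (inv_nonneg.2 hy'.le) (norm_nonneg _), ← Finset.mul_sum] at h
    rwa [Real.inv_rpow hy'.le, inv_mul_le_iff₀ (Real.rpow_pos_of_pos hy' _), mul_comm] at h

theorem norm_toContinuousLinearMap_le (B : ContinuousMultilinearMap 𝕜 E F) (z : ∀ m, E m)
    (i : Fin n) :
    ‖B.toContinuousLinearMap z i‖ ≤ ‖B‖ * ∏ m ∈ Finset.univ.erase i, ‖z m‖ := by
  refine ContinuousLinearMap.opNorm_le_bound _ (by positivity) fun x => ?_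
  refine (B.le_opNorm _).trans (le_of_eq ?_)
  rw [← Finset.mul_prod_erase _ _ (Finset.mem_univ i), Function.update_self,
    Finset.prod_congr rfl fun m hm => by rw [Function.update_of_ne (Finset.ne_of_mem_erase hm)]]
  ring

theorem isAverageBounded_compContinuousLinearMap {p : ℝ} (hp : 1 < p)
    {G : Fin n → Type*} [∀ m, NormedAddCommGroup (G m)] [∀ m, NormedSpace 𝕜 (G m)]
    (u : ∀ m, E m →L[𝕜] G m) (B : ContinuousMultilinearMap 𝕜 G F) (i : Fin n)
    (hu : IsCohenStronglySummingLinear p (u i)) :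
    ∃ K : ℝ, 0 ≤ K ∧
      IsAverageBounded (B.compContinuousLinearMap u) i p (p / (p - 1)) K := by
  obtain ⟨C, hC, h⟩ := hu.exists_isAverageBounded hp
  refine ⟨C * ‖B‖ * ∏ m ∈ Finset.univ.erase i, ‖u m‖, by positivity,
    fun N z x φ b d hb hd hx hφ => ?_⟩
  have hq : 0 < p / (p - 1) := div_pos (by linarith) (by linarith)
  set v := B.toContinuousLinearMap (fun m => u m (z m)) i with hv
  set V : StrongDual 𝕜 F →L[𝕜] StrongDual 𝕜 (G i) :=
    (ContinuousLinearMap.compL 𝕜 (G i) F 𝕜).flip v with hV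
  set τ := ‖B‖ * ∏ m ∈ Finset.univ.erase i, (‖u m‖ * ‖z m‖) with hτ
  have hτ0 : 0 ≤ τ := by positivity
  have hvτ : ‖v‖ ≤ τ := (norm_toContinuousLinearMap_le B _ i).trans <| by
    rw [hτ]
    gcongr with m
    exact (u m).le_opNorm _
  have hVv : ‖V‖ ≤ ‖v‖ := ContinuousLinearMap.opNorm_le_bound _ (norm_nonneg _) fun ψ => by
    rw [mul_comm]; exact ContinuousLinearMap.opNorm_comp_le _ _
  have key := h N x (fun ε => V (φ ε)) b (d * τ) hb (by positivity) hx fun y hy => by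
    have h1 := sum_norm_rpow_le_of_weak hq hφ (y.comp V)
    refine h1.trans ?_
    rw [Real.mul_rpow hd hτ0, mul_assoc]
    gcongr
    exact (ContinuousLinearMap.opNorm_comp_le _ _).trans
      ((mul_le_of_le_one_left (norm_nonneg _) hy).trans (hVv.trans hvτ))
  have hval : ∀ ε, V (φ ε) (u i (x ε)) =
      φ ε (B.compContinuousLinearMap u (Function.update z i (x ε))) := fun ε => by
    change φ ε (B (Function.update (fun m => u m (z m)) i (u i (x ε)))) =
      φ ε (B fun m => u m (Function.update z i (x ε) m))
    congr 2
    funext m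
    by_cases hm : m = i
    · subst hm; simp
    · simp [hm]
  simp only [hval] at key
  refine key.trans (le_of_eq ?_)
  rw [hτ, Finset.prod_mul_distrib]
  ring

theorem map_signSum {E F : Type*} [NormedAddCommGroup E] [NormedSpace 𝕜 E]
    [NormedAddCommGroup F] [NormedSpace 𝕜 F] (y : E →L[𝕜] F) {N : ℕ} (x : ℕ → E)
    (ε : Fin N → ℤˣ) : y (signSum 𝕜 x ε) = signSum 𝕜 (fun j => y (x j)) ε := by
  simp [signSum, map_sum]

/-- The passage from averages to diagonal sums in one variable. The Cohen inequality is applied to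
the families of all signed sums `∑ ε_j x_j` and `∑ ε_j φ_j`, indexed by the signs: the weak `q`-norm
of the second is controlled by the weak `2`-norm of `(φ_j)`, by Khintchine's inequality. -/
theorem IsAverageBounded.exists_single_variable_bound {A : ContinuousMultilinearMap 𝕜 E F}
    {i : Fin n} {r q K : ℝ} (hq : 0 < q) (hK : 0 ≤ K) (hA : IsAverageBounded A i r q K) :
    ∃ C : ℝ, 0 ≤ C ∧ ∀ (N : ℕ) (z : ∀ m, E m) (x : ℕ → E i) (φ : ℕ → StrongDual 𝕜 F) (b : ℝ),
      0 ≤ b → ∑ ε : Fin N → ℤˣ, ‖signSum 𝕜 x ε‖ ^ r ≤ 2 ^ N * b ^ r →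
      (∀ y : StrongDual 𝕜 (StrongDual 𝕜 F), ‖y‖ ≤ 1 → ∑ j : Fin N, ‖y (φ j)‖ ^ 2 ≤ 1) →
      ‖∑ j : Fin N, φ j (A (Function.update z i (x j)))‖ ≤
        C * b * ∏ m ∈ Finset.univ.erase i, ‖z m‖ := by
  obtain ⟨κ, hκ, hkh⟩ := exists_khintchine 𝕜 q hq.le
  refine ⟨K * κ ^ (1 / q), by positivity, fun N z x φ b hb hx hφ => ?_⟩
  have h1 := hA N z (fun ε => signSum 𝕜 x ε) (fun ε => signSum 𝕜 φ ε) b (κ ^ (1 / q)) hb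
    (by positivity) hx fun y hy => by
      simp only [map_signSum]
      rw [← Real.rpow_mul hκ, one_div_mul_cancel hq.ne', Real.rpow_one]
      exact hkh N _ (hφ y hy)
  have h2 := sum_signs_decouple (𝕜 := 𝕜) N
    (fun j => (((φ j).comp (A.toContinuousLinearMap z i) : E i →L[𝕜] 𝕜) : E i →ₗ[𝕜] 𝕜)) x
  have h3 : ∀ ε : Fin N → ℤˣ, ∑ j : Fin N, ((ε j : ℤ) : 𝕜) *
      (((φ j).comp (A.toContinuousLinearMap z i) : E i →L[𝕜] 𝕜) : E i →ₗ[𝕜] 𝕜)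
        (signSum 𝕜 x ε) =
      signSum 𝕜 φ ε (A (Function.update z i (signSum 𝕜 x ε))) := fun ε => by
    conv_rhs => rw [signSum]
    rw [sum_apply]
    rfl
  simp only [h3] at h2
  have h4 : 2 ^ N * ‖∑ j : Fin N, φ j (A (Function.update z i (x j)))‖ ≤
      ∑ ε : Fin N → ℤˣ, ‖signSum 𝕜 φ ε (A (Function.update z i (signSum 𝕜 x ε)))‖ := by
    refine le_trans (le_of_eq ?_) (norm_sum_le _ _)
    rw [h2, norm_mul, norm_pow, RCLike.norm_ofNat]
    rfl
  have h5 := h4.trans h1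
  rw [mul_le_mul_iff_right₀ (by positivity)] at h5
  exact h5

/-- The variables other than `i` are treated one at a time: decoupling replaces the sequence in
such a variable by a fixed vector, a signed sum of the sequence, and changes the signs of the
functionals, which does not affect their weak norm. -/
theorem IsAverageBounded.exists_diagonal_bound {A : ContinuousMultilinearMap 𝕜 E F}
    {i : Fin n} {r q K : ℝ} (hq : 0 < q) (hK : 0 ≤ K) (hA : IsAverageBounded A i r q K) :
    ∃ C : ℝ, 0 ≤ C ∧ ∀ (N : ℕ) (s : Finset (Fin n)), i ∉ s →
      ∀ (x : ∀ m, ℕ → E m) (φ : ℕ → StrongDual 𝕜 F) (b : Fin n → ℝ), 0 ≤ b i →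
      ∑ ε : Fin N → ℤˣ, ‖signSum 𝕜 (x i) ε‖ ^ r ≤ 2 ^ N * b i ^ r →
      (∀ m ∈ s, ∑ ε : Fin N → ℤˣ, ‖signSum 𝕜 (x m) ε‖ ≤ 2 ^ N * b m) →
      (∀ m, m ≠ i → m ∉ s → ‖x m 0‖ ≤ b m ∧ ∀ j, x m j = x m 0) →
      (∀ y : StrongDual 𝕜 (StrongDual 𝕜 F), ‖y‖ ≤ 1 → ∑ j : Fin N, ‖y (φ j)‖ ^ 2 ≤ 1) →
      ‖∑ j : Fin N, φ j (A fun m => x m j)‖ ≤ C * ∏ m, b m := by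
  obtain ⟨C, hC, h⟩ := hA.exists_single_variable_bound hq hK
  refine ⟨C, hC, fun N s => ?_⟩
  induction s using Finset.induction_on with
  | empty =>
    intro _ x φ b hb hi _ hconst hφ
    have h1 : ∀ j : Fin N, (fun m => x m j) = Function.update (fun m => x m 0) i (x i j) := by
      intro j
      funext m
      by_cases hm : m = i
      · subst hm; simp
      · rw [Function.update_of_ne hm, (hconst m hm (by simp)).2]
    simp only [h1]
    refine (h N (fun m => x m 0) (x i) φ (b i) hb hi hφ).trans ?_
    rw [← Finset.mul_prod_erase _ _ (Finset.mem_univ i), ← mul_assoc]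
    gcongr with m hm
    exact (hconst m (Finset.ne_of_mem_erase hm) (by simp)).1
  | insert a s has ih =>
    intro his x φ b hb hi hs hconst hφ
    rw [Finset.mem_insert, not_or] at his
    obtain ⟨hia, his⟩ := his
    have hstep : ∀ ε : Fin N → ℤˣ,
        ‖∑ j : Fin N, ((ε j : ℤ) : 𝕜) *
          φ j (A (Function.update (fun m => x m j) a (signSum 𝕜 (x a) ε)))‖ ≤
        C * (‖signSum 𝕜 (x a) ε‖ * ∏ m ∈ Finset.univ.erase a, b m) := by
      intro ε
      have h1 := ih his (Function.update x a fun _ => signSum 𝕜 (x a) ε)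
        (fun j => if hj : j < N then ((ε ⟨j, hj⟩ : ℤ) : 𝕜) • φ j else 0)
        (Function.update b a ‖signSum 𝕜 (x a) ε‖)
        (by rwa [Function.update_of_ne hia])
        (by rwa [Function.update_of_ne hia, Function.update_of_ne hia])
        (fun m hm => by
          have hma : m ≠ a := fun h => has (h ▸ hm)
          rw [Function.update_of_ne hma, Function.update_of_ne hma]
          exact hs m (Finset.mem_insert_of_mem hm))
        (fun m hmi hms => by
          by_cases hma : m = a
          · subst hma; simp
          · rw [Function.update_of_ne hma, Function.update_of_ne hma]
            exact hconst m hmi (by simp [hma, hms]))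
        (fun y hy => by simpa [norm_smul, norm_intUnits_cast] using hφ y hy)
      rw [Finset.prod_update_of_mem (Finset.mem_univ a), ← Finset.erase_eq] at h1
      refine le_trans (le_of_eq ?_) h1
      congr 1
      refine Finset.sum_congr rfl fun j _ => ?_
      have h2 : (fun m => Function.update x a (fun _ => signSum 𝕜 (x a) ε) m j) =
          Function.update (fun m => x m j) a (signSum 𝕜 (x a) ε) := by
        funext m
        by_cases hm : m = a
        · subst hm; simp
        · simp [hm]
      rw [h2]
      simp
    have hdec := sum_signs_decouple (𝕜 := 𝕜) N (fun j : Fin N =>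
      (((φ j).comp (A.toContinuousLinearMap (fun m => x m j) a) : E a →L[𝕜] 𝕜) :
        E a →ₗ[𝕜] 𝕜)) (x a)
    have hL : ∀ (j : Fin N) (v : E a),
        (((φ j).comp (A.toContinuousLinearMap (fun m => x m j) a) : E a →L[𝕜] 𝕜) :
        E a →ₗ[𝕜] 𝕜) v = φ j (A (Function.update (fun m => x m j) a v)) := fun _ _ => rfl
    have hself : ∀ j : Fin N, Function.update (fun m => x m j) a (x a j) = fun m => x m j :=
      fun j => Function.update_eq_self a (fun m => x m j)
    simp only [hL, hself] at hdec
    have hprod : 0 ≤ ∏ m ∈ Finset.univ.erase a, b m := by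
      refine Finset.prod_nonneg fun m hm => ?_
      by_cases hmi : m = i
      · rwa [hmi]
      by_cases hms : m ∈ s
      · have h0 : (0 : ℝ) ≤ 2 ^ N * b m :=
          (Finset.sum_nonneg fun _ _ => norm_nonneg _).trans (hs m (Finset.mem_insert_of_mem hms))
        exact nonneg_of_mul_nonneg_right h0 (by positivity)
      · exact (norm_nonneg _).trans
          (hconst m hmi (by simp [hms, Finset.ne_of_mem_erase hm])).1
    have h4 : 2 ^ N * ‖∑ j : Fin N, φ j (A fun m => x m j)‖ ≤ 2 ^ N * (C * ∏ m, b m) := by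
      calc _ = ‖(2 : 𝕜) ^ N * ∑ j : Fin N, φ j (A fun m => x m j)‖ := by
            rw [norm_mul, norm_pow, RCLike.norm_ofNat]
        _ ≤ ∑ ε : Fin N → ℤˣ, C * (‖signSum 𝕜 (x a) ε‖ * ∏ m ∈ Finset.univ.erase a, b m) := by
            rw [← hdec]
            exact (norm_sum_le _ _).trans (Finset.sum_le_sum fun ε _ => hstep ε)
        _ ≤ C * ((2 ^ N * b a) * ∏ m ∈ Finset.univ.erase a, b m) := by
            rw [← Finset.mul_sum, ← Finset.sum_mul]
            gcongr
            exact hs a (Finset.mem_insert_self a s)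
        _ = _ := by
            rw [← Finset.mul_prod_erase _ _ (Finset.mem_univ a)]
            ring
    exact le_of_mul_le_mul_left h4 (by positivity)

/-- Almost unconditionally summable sequences have bounded Rademacher moments, so that the
diagonal sums are bounded independently of their length. -/
theorem IsAverageBounded.isCohenAlmostSumming {A : ContinuousMultilinearMap 𝕜 E F}
    {i : Fin n} {r q K : ℝ} (hr : 0 < r) (hq : 0 < q) (hK : 0 ≤ K)
    (hA : IsAverageBounded A i r q K) : IsCohenAlmostSumming A := by
  intro x hx
  obtain ⟨C, hC, h⟩ := hA.exists_diagonal_bound hq hK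
  obtain ⟨R, hR, hRx⟩ := exists_moment_bound_of_mem_Rad (hx i) r hr.le
  choose R' _ hRx' using fun m => exists_moment_bound_of_mem_Rad (hx m) 1 zero_le_one
  set b := Function.update R' i (R ^ (1 / r)) with hb
  have hbound : ∀ (N : ℕ) (φ : ℕ → StrongDual 𝕜 F),
      (∀ y : StrongDual 𝕜 (StrongDual 𝕜 F), ‖y‖ ≤ 1 → ∑ j : Fin N, ‖y (φ j)‖ ^ 2 ≤ 1) →
      ‖∑ j : Fin N, φ j (A fun m => x m j)‖ ≤ C * ∏ m, b m := by
    intro N φ hφ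
    refine h N (Finset.univ.erase i) (by simp) x φ b ?_ ?_ ?_ ?_ hφ
    · rw [hb, Function.update_self]; positivity
    · rw [hb, Function.update_self, ← Real.rpow_mul hR, one_div_mul_cancel hr.ne', Real.rpow_one]
      exact hRx N
    · intro m hm
      rw [hb, Function.update_of_ne (Finset.ne_of_mem_erase hm)]
      simpa using hRx' m N
    · intro m hmi hm
      exact absurd (Finset.mem_erase.2 ⟨hmi, Finset.mem_univ m⟩) hm
  change cohenNorm 𝕜 2 _ < ∞
  refine lt_of_le_of_lt (b := ENNReal.ofReal (C * ∏ m, b m)) ?_ (by simp)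
  refine iSup₂_le fun φ hφ => ?_
  rw [weakNorm_le_one_iff (by norm_num)] at hφ
  refine ENNReal.tsum_le_of_sum_range_le fun N => ?_
  -- Unimodular factors turn the sum of absolute values into a sum of values.
  choose c hc hcφ using fun j => RCLike.exists_norm_eq_mul_self (φ j (A fun m => x m j))
  have h1 := hbound N (fun j => c j • φ j) fun y hy => by
    have h2 := (ENNReal.sum_le_tsum (Finset.range N)).trans (hφ y hy)
    simp only [enorm_rpow_eq_ofReal _ (show (0 : ℝ) ≤ 2 / (2 - 1) by norm_num)] at h2
    rw [← ENNReal.ofReal_sum_of_nonneg fun _ _ => by positivity, ENNReal.ofReal_le_one] at h2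
    norm_num at h2
    simpa [norm_smul, hc, Finset.sum_range] using h2
  simp only [smul_apply, smul_eq_mul, ← hcφ] at h1
  rw [Fin.sum_univ_eq_sum_range (fun j => ((‖φ j (A fun m => x m j)‖ : ℝ) : 𝕜)) N,
    ← RCLike.ofReal_sum, RCLike.norm_ofReal,
    abs_of_nonneg (Finset.sum_nonneg fun _ _ => norm_nonneg _)] at h1
  simp only [← ofReal_norm]
  rw [← ENNReal.ofReal_sum_of_nonneg fun _ _ => norm_nonneg _]
  exact ENNReal.ofReal_le_ofReal h1

end Averages

theorem mainTheorem5 {𝕜 : Type*} [RCLike 𝕜] {n : ℕ} (hn : 1 ≤ n) {p : ℝ} (hp : 1 < p)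
    {E : Fin n → Type*} [∀ m, NormedAddCommGroup (E m)] [∀ m, NormedSpace 𝕜 (E m)]
    [∀ m, CompleteSpace (E m)]
    {G : Fin n → Type*} [∀ m, NormedAddCommGroup (G m)] [∀ m, NormedSpace 𝕜 (G m)]
    [∀ m, CompleteSpace (G m)]
    {F : Type*} [NormedAddCommGroup F] [NormedSpace 𝕜 F] [CompleteSpace F] :
    (∀ A : ContinuousMultilinearMap 𝕜 E F,
      IsCohenStronglySumming p A → IsCohenAlmostSumming A) ∧
    (∀ (u : ∀ m, E m →L[𝕜] G m) (B : ContinuousMultilinearMap 𝕜 G F),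
      (∀ m, IsCohenStronglySummingLinear p (u m)) →
        IsCohenAlmostSumming (B.compContinuousLinearMap u)) := by
  have hp0 : 0 < p := by linarith
  have hq : 0 < p / (p - 1) := div_pos hp0 (by linarith)
  have hn0 : (0 : ℝ) < n := by exact_mod_cast hn
  let i : Fin n := ⟨0, hn⟩
  refine ⟨fun A hA => ?_, fun u B hu => ?_⟩
  · obtain ⟨K, hK, h⟩ := hA.exists_isAverageBounded hn hp i
    exact h.isCohenAlmostSumming (mul_pos hn0 hp0) hq hK
  · obtain ⟨K, hK, h⟩ := isAverageBounded_compContinuousLinearMap hp u B i (hu i)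
    exact h.isCohenAlmostSumming hp0 hq hK
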